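/- **Setting (multi-choice stochastic knapsack with costs).** An instance $I$ has $n$ items with $m$ choices each and a knapsack of size $1$. Item $i$ has value $v_i\ge 0$; choice $j$ of item $i$ has cost $p_i^j\ge 0$ and a finitely supported size distribution $F_i^j$ on $[0,\infty)$; sizes are independent. A policy selects item-choice pairs one at a time, each item at most once. The cost is paid up front, then the size is realized; the value $v_i$ is obtained if the total size of the selected items is still at most $1$, and otherwise (overflow) the process ends. The profit is the total value obtained minus the total cost paid. An adaptive policy chooses the next pair, or stops, depending on the set of unselected items and the remaining budget; $\mathrm{ADAPT}(I)$ is the optimal expected profit of an adaptive policy. A stopping-time adaptive policy fixes an order of pairs with distinct items in advance and may only stop adaptively. Let $w_{ij}=v_i\Pr_{s\sim F_i^j}[s\le 1]-p_i^j$, where $1$ is the true budget, and let $\mu_{ij}(t)=\mathbb E_{s\sim F_i^j}[\min\{s,t\}]$. Let $\alpha=\max_{i,j}\,p_i^j/w_{ij}$ be the inverse return on investment, where a choice with $p_i^j=0$ counts as $0$; we assume that $w_{ij}\neq 0$ whenever $p_i^j>0$, so that $\alpha$ is well defined and finite. Give each item in addition a null choice $\bot$ with $w_{i\bot}=\mu_{i\bot}=0$,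 whose selection does nothing, and let $$\Phi(t)=\max\Big\{\sum_{i,j} w_{ij}x_{ij}\;:\;\sum_{i,j}\mu_{ij}(t)x_{ij}\le t,\ \ \sum_j x_{ij}=1\ \ \forall i,\ \ x_{ij}\ge 0\Big\}.$$ **Algorithm.** SKC-OF$(t)$ takes an optimal solution $x$ of $\Phi(t)$ in which at most one item has two positive entries $x_{ij}$ and every other item has exactly one. Put $w_i=\sum_j w_{ij}x_{ij}$ and $\mu_i=\sum_j\mu_{ij}(t)x_{ij}$; whenever item $i$ is attempted, choice $j$ is used with probability $x_{ij}$. If $\max_i w_i>\Phi(t)/4$, only one item with the largest $w_i$ is attempted; otherwise the items are attempted in order of decreasing density $w_i/\mu_i$ (infinite if $\mu_i=0<w_i$), ties broken arbitrarily. SKC-BOUND runs SKC-OF$(\delta)$ in the true knapsack of size $1$, and stops as soon as the total size of the selected items exceeds $\delta$. Once the random choice for the one fractional item (if any) is drawn, SKC-BOUND is a stopping-time adaptive policy. **Theorem.** There is a universal constant $C>0$ such that the following holds. Let $\delta\in(0,1)$, and let $I$ be an instance with $$\Pr_{s\sim F_i^j}[s>1-\delta]\le\frac1{2n\alpha}\qquad\text{for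 all } i,j$$ (if $\alpha\le 0$, this condition is void). Then a solution $x$ and an order as required by SKC-OF$(\delta)$ exist, and for every such $x$ and order, $$\mathrm{ADAPT}(I)\le\frac{C}{\delta}\;\mathbb E[\text{SKC-BOUND}(I)].$$ -/

import Mathlib

/-- An instance of the multi-choice stochastic knapsack problem with costs: `n` items with `m`
choices each; the knapsack has size `1`.  Choice `j` of item `i` costs `p i j`, and its size is
drawn from the finitely supported distribution on `supp i j` with point masses `prob i j s`. -/
structure MSKC (n m : ℕ) where
  v : Fin n → ℝ
  p : Fin n → Fin m → ℝ
  supp : Fin n → Fin m → Finset ℝ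
  prob : Fin n → Fin m → ℝ → ℝ
  v_nonneg : ∀ i, 0 ≤ v i
  p_nonneg : ∀ i j, 0 ≤ p i j
  size_nonneg : ∀ i j, ∀ s ∈ supp i j, 0 ≤ s
  prob_nonneg : ∀ i j s, 0 ≤ prob i j s
  prob_sum : ∀ i j, ∑ s ∈ supp i j, prob i j s = 1

noncomputable section

namespace MSKC

variable {n m : ℕ} (I : MSKC n m)

/-- `𝔼[f(s)]` for the size `s` of choice `j` of item `i`. -/
def sizeExp (i : Fin n) (j : Fin m) (f : ℝ → ℝ) : ℝ :=
  ∑ s ∈ I.supp i j, I.prob i j s * f s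

open Classical in
/-- `Pr[s ∈ A]` for the size `s` of choice `j` of item `i`. -/
def sizePr (i : Fin n) (j : Fin m) (A : Set ℝ) : ℝ :=
  I.sizeExp i j (fun s => if s ∈ A then 1 else 0)

/-- `w i j = v i * Pr[s ≤ 1] - p i j`: the expected net profit of choice `j` of item `i` when it is
inserted into the empty knapsack (of size `1`). -/
def w (i : Fin n) (j : Fin m) : ℝ :=
  I.v i * I.sizePr i j (Set.Iic 1) - I.p i j

/-- The expected size truncated at `t`. -/
def mu (t : ℝ) (i : Fin n) (j : Fin m) : ℝ :=
  I.sizeExp i j (fun s => min s t)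

/-- Return on investment of a choice. -/
def roi (i : Fin n) (j : Fin m) : ℝ :=
  I.w i j / I.p i j

/-- The IOR parameter `α`: the maximum of `1 / ROI` over all choices of all items.  (A choice of
cost `0` has infinite return on investment and contributes `0`; so it does here, as
`w / 0 = 0` and `0⁻¹ = 0`.) -/
def ior : ℝ :=
  ⨆ ij : Fin n × Fin m, (I.roi ij.1 ij.2)⁻¹

/-! ### Adaptive policies -/

/-- A fully adaptive policy maps the set of items not yet selected and the remaining budget to the
next item-choice pair, or to `none` if it stops. -/
structure AdaptivePolicy (n m : ℕ) where
  next : Finset (Fin n) → ℝ → Option (Fin n × Fin m)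
  next_mem : ∀ J b i j, next J b = some (i, j) → i ∈ J

/-- Expected profit that the policy makes in its next (at most) `k` selections, from the state with
remaining items `J` and remaining budget `b`.  The cost is paid up front, the value is obtained if
the item fits, and an overflow ends the process. -/
def adaptiveProfitFrom (φ : AdaptivePolicy n m) : ℕ → Finset (Fin n) → ℝ → ℝ
  | 0, _, _ => 0
  | k + 1, J, b =>
    match φ.next J b with
    | none => 0
    | some (i, j) =>
      - I.p i j + I.sizeExp i j (fun s =>
        if s ≤ b then I.v i + adaptiveProfitFrom φ k (J.erase i) (b - s) else 0)

/-- Expected profit of an adaptive policy with budget `1`; at most `n` selections are possible. -/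
def adaptiveProfit (φ : AdaptivePolicy n m) : ℝ :=
  I.adaptiveProfitFrom φ n Finset.univ 1

/-- The optimal expected profit of an adaptive policy. -/
def ADAPT : ℝ :=
  ⨆ φ : AdaptivePolicy n m, I.adaptiveProfit φ

theorem adaptiveProfitFrom_le (φ : AdaptivePolicy n m) (k : ℕ) (J : Finset (Fin n)) (b : ℝ) :
    I.adaptiveProfitFrom φ k J b ≤ k * ∑ i, I.v i := by
  have hV : 0 ≤ ∑ i, I.v i := Finset.sum_nonneg fun i _ => I.v_nonneg i
  induction k generalizing J b with
  | zero => simp [adaptiveProfitFrom]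
  | succ k ih =>
    have h0 : 0 ≤ ((k + 1 : ℕ) : ℝ) * ∑ i, I.v i := mul_nonneg (Nat.cast_nonneg _) hV
    unfold adaptiveProfitFrom
    split
    · exact h0
    · rename_i i j _
      have hp := I.p_nonneg i j
      have key : I.sizeExp i j (fun s =>
          if s ≤ b then I.v i + I.adaptiveProfitFrom φ k (J.erase i) (b - s) else 0)
          ≤ ((k + 1 : ℕ) : ℝ) * ∑ i, I.v i := by
        calc _ ≤ ∑ s ∈ I.supp i j, I.prob i j s * (((k + 1 : ℕ) : ℝ) * ∑ i, I.v i) := by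
              refine Finset.sum_le_sum fun s _ =>
                mul_le_mul_of_nonneg_left ?_ (I.prob_nonneg i j s)
              beta_reduce
              split
              · have h1 : I.v i ≤ ∑ i, I.v i :=
                  Finset.single_le_sum (fun i _ => I.v_nonneg i) (Finset.mem_univ i)
                have h2 := ih (J.erase i) (b - s)
                push_cast
                linarith
              · exact h0
          _ = _ := by rw [← Finset.sum_mul, I.prob_sum, one_mul]
      linarith

/-- The supremum defining `ADAPT` is over a bounded set. -/
theorem bddAbove_adaptiveProfit : BddAbove (Set.range I.adaptiveProfit) :=
  ⟨n * ∑ i, I.v i, by rintro _ ⟨φ, rfl⟩; exact I.adaptiveProfitFrom_le φ n _ _⟩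

/-! ### Stopping-time adaptive policies -/

/-- A stopping-time adaptive policy fixes an order of item-choice pairs (each item at most once) in
advance, and may halt depending on the sizes realized so far (listed from last to first). -/
structure StoppingPolicy (n m : ℕ) where
  order : List (Fin n × Fin m)
  nodup : (order.map Prod.fst).Nodup
  halt : List ℝ → Prop

open Classical in
/-- Expected profit from the remaining pairs, when the sizes realized so far are `h` and the
remaining budget is `b`. -/
def stoppingProfitFrom (halt : List ℝ → Prop) : List (Fin n × Fin m) → List ℝ → ℝ → ℝ
  | [], _, _ => 0
  | (i, j) :: l, h, b =>
    if halt h then 0 else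
      - I.p i j + I.sizeExp i j (fun s =>
        if s ≤ b then I.v i + stoppingProfitFrom halt l (s :: h) (b - s) else 0)

/-- Expected profit of a stopping-time adaptive policy with budget `1`. -/
def stoppingProfit (π : StoppingPolicy n m) : ℝ :=
  I.stoppingProfitFrom π.halt π.order [] 1

/-! ### The linear program -/

/-- Every item has, besides its `m` choices, a null choice `none` of zero size, value and cost. -/
def w' (i : Fin n) : Option (Fin m) → ℝ
  | none => 0
  | some j => I.w i j

def mu' (t : ℝ) (i : Fin n) : Option (Fin m) → ℝ
  | none => 0
  | some j => I.mu t i j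

/-- Feasible solutions of the linear program with parameter `t`. -/
def lpFeasible (t : ℝ) : Set (Fin n → Option (Fin m) → ℝ) :=
  {x | ∑ i, ∑ j, I.mu' t i j * x i j ≤ t ∧ (∀ i, ∑ j, x i j = 1) ∧ ∀ i j, 0 ≤ x i j}

def lpValue (x : Fin n → Option (Fin m) → ℝ) : ℝ :=
  ∑ i, ∑ j, I.w' i j * x i j

/-- `Φ(t)`, the optimal value of the linear program. -/
def Phi (t : ℝ) : ℝ :=
  sSup (I.lpValue '' I.lpFeasible t)

/-- Profit `w_i` of item `i` in the candidate set given by `x`: if `x i j = 1` this is `w i j`, and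
if `x i` has two positive entries `j, j'` it is the profit `w i j * x i j + w i j' * x i j'` of the
virtual choice of `i`. -/
def candW (x : Fin n → Option (Fin m) → ℝ) (i : Fin n) : ℝ :=
  ∑ j, I.w' i j * x i j

/-- Expected truncated size of item `i` in the candidate set. -/
def candMu (t : ℝ) (x : Fin n → Option (Fin m) → ℝ) (i : Fin n) : ℝ :=
  ∑ j, I.mu' t i j * x i j

/-- `x` is an optimal solution of the linear program in which no item has more than two positive
choices, and at most one item has two positive choices (so that any other item `i` has `x i j = 1`
for one choice `j`). -/
structure IsStructuredOptimal (t : ℝ) (x : Fin n → Option (Fin m) → ℝ) : Prop where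
  feasible : x ∈ I.lpFeasible t
  optimal : ∀ y ∈ I.lpFeasible t, I.lpValue y ≤ I.lpValue x
  card_le_two : ∀ i, {j | 0 < x i j}.ncard ≤ 2
  unique_virtual : ∀ i i', 1 < {j | 0 < x i j}.ncard → 1 < {j | 0 < x i' j}.ncard → i = i'

/-! ### The algorithm -/

/-- A run of the algorithm SKC-OF with budget `t`: a structured optimal solution `x` of the linear
program, and the order in which the candidate items are attempted (items whose candidate choice is
null are harmless: attempting them does nothing).  If the largest `w_i` is above the threshold
`Φ(t) / 4`, one item with the largest `w_i` is the only one attempted; otherwise all are attempted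
by decreasing density `w_i / μ_i`, compared by cross-multiplication, so that `μ_i = 0` with
`0 < w_i` is an infinite density.  Ties may be broken in any way. -/
structure SKCRun (t : ℝ) where
  x : Fin n → Option (Fin m) → ℝ
  structured : I.IsStructuredOptimal t x
  items : List (Fin n)
  nodup : items.Nodup
  spec :
    (∃ i, I.Phi t / 4 < I.candW x i ∧ (∀ k, I.candW x k ≤ I.candW x i) ∧ items = [i]) ∨
    ((∀ i, I.candW x i ≤ I.Phi t / 4) ∧ (∀ i, i ∈ items) ∧
      items.Pairwise (fun i k => I.candW x k * I.candMu t x i ≤ I.candW x i * I.candMu t x k))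

theorem nodup_choices {items : List (Fin n)} (h : items.Nodup) (κ : Fin n → Option (Fin m)) :
    ((items.filterMap (fun i => (κ i).map (fun j => (i, j)))).map Prod.fst).Nodup := by
  refine List.Nodup.sublist ?_ h
  induction items with
  | nil => simp
  | cons a l ih =>
    have ih' := ih (List.nodup_cons.mp h).2
    cases hκ : κ a with
    | none => simpa [List.filterMap_cons, hκ] using ih'.cons a
    | some j => simpa [List.filterMap_cons, hκ] using ih'

variable {I}

/-- SKC-BOUND, once the random choice `κ i` of every item `i` has been drawn: the stopping-time
adaptive policy that attempts the items in the order of the run with budget `δ`, and stops as soon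
as the total size of the selected items exceeds `δ`. -/
def SKCRun.boundPolicy {δ : ℝ} (R : I.SKCRun δ) (κ : Fin n → Option (Fin m)) :
    StoppingPolicy n m where
  order := R.items.filterMap (fun i => (κ i).map (fun j => (i, j)))
  nodup := nodup_choices R.nodup κ
  halt := fun h => δ < h.sum

/-- `𝔼[SKC-BOUND]`, in the true knapsack of size `1`: item `i` is attempted with choice `j` with
probability `x i j`.  (Only the virtual item, if any, is really random, so that this is a mixture of
at most two stopping-time adaptive policies.) -/
def SKCRun.boundProfit {δ : ℝ} (R : I.SKCRun δ) : ℝ :=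
  ∑ κ : Fin n → Option (Fin m), (∏ i, R.x i (κ i)) * I.stoppingProfit (R.boundPolicy κ)

end MSKC

end

noncomputable section

namespace MSKC

variable {n m : ℕ} (I : MSKC n m)

/-! ### Sizes -/

/-! The value `Φ(δ)` lies between the two sides: `ADAPT ≤ (2/δ) Φ(δ)` and `Φ(δ)/64 ≤ 𝔼[SKC-BOUND]`,
so `C = 128` works.

Upper bound (`ADAPT_le_Phi`): the selection probabilities of an adaptive policy satisfy the
constraints of the linear program, except that their expected truncated size may reach `1 + δ ≤ 2`;
scaling by `δ/2` repairs this.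

Lower bound (`SKCRun.Phi_le_boundProfit`): if some `w_i` exceeds `Φ/4`, one item suffices. Otherwise
each choice's gain, when a total size `T ≤ δ` is already used, is bounded below by an affine
function of `T` that is nonpositive at `T = δ`. Stopping beyond `δ` then costs nothing against the
bound, and `mixedProfit_ge` replaces the sizes by their truncated means. What is lost is a sum of
`μ_i w_k` over pairs with `i` before `k`; the density order makes it at most half of `(∑ μ_i)(∑ w_i)
≤ δ Φ`.

The affine bounds come from two regimes. If `α ≤ 1/6`, costs are small and Markov's inequality is
enough. If `α > 1/6`, the hypothesis on sizes above `1 - δ` keeps a constant fraction of each `w`.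
-/

theorem sizeExp_mono {i : Fin n} {j : Fin m} {f g : ℝ → ℝ} (h : ∀ s, 0 ≤ s → f s ≤ g s) :
    I.sizeExp i j f ≤ I.sizeExp i j g :=
  Finset.sum_le_sum fun s hs =>
    mul_le_mul_of_nonneg_left (h s (I.size_nonneg i j s hs)) (I.prob_nonneg i j s)

theorem sizeExp_add (i : Fin n) (j : Fin m) (f g : ℝ → ℝ) :
    I.sizeExp i j (fun s => f s + g s) = I.sizeExp i j f + I.sizeExp i j g := by
  simp only [sizeExp, mul_add, Finset.sum_add_distrib]

theorem sizeExp_const_mul (i : Fin n) (j : Fin m) (c : ℝ) (f : ℝ → ℝ) :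
    I.sizeExp i j (fun s => c * f s) = c * I.sizeExp i j f := by
  simp only [sizeExp, Finset.mul_sum]
  exact Finset.sum_congr rfl fun s _ => by ring

theorem sizeExp_const (i : Fin n) (j : Fin m) (c : ℝ) : I.sizeExp i j (fun _ => c) = c := by
  rw [sizeExp, ← Finset.sum_mul, I.prob_sum, one_mul]

theorem sizeExp_le_const {i : Fin n} {j : Fin m} {f : ℝ → ℝ} {c : ℝ}
    (h : ∀ s, 0 ≤ s → f s ≤ c) : I.sizeExp i j f ≤ c :=
  (I.sizeExp_mono h).trans_eq (I.sizeExp_const i j c)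

theorem const_le_sizeExp {i : Fin n} {j : Fin m} {f : ℝ → ℝ} {c : ℝ}
    (h : ∀ s, 0 ≤ s → c ≤ f s) : c ≤ I.sizeExp i j f :=
  (I.sizeExp_const i j c).symm.trans_le (I.sizeExp_mono h)

theorem sizeExp_finset_sum {ι : Type*} (t : Finset ι) (i : Fin n) (j : Fin m) (f : ι → ℝ → ℝ) :
    I.sizeExp i j (fun s => ∑ k ∈ t, f k s) = ∑ k ∈ t, I.sizeExp i j (f k) := by
  simp only [sizeExp, Finset.mul_sum]
  exact Finset.sum_comm

theorem sizePr_nonneg (i : Fin n) (j : Fin m) (A : Set ℝ) : 0 ≤ I.sizePr i j A :=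
  I.const_le_sizeExp fun _ _ => by split_ifs <;> norm_num

theorem sizePr_le_one (i : Fin n) (j : Fin m) (A : Set ℝ) : I.sizePr i j A ≤ 1 :=
  I.sizeExp_le_const fun _ _ => by split_ifs <;> norm_num

theorem sizePr_mono (i : Fin n) (j : Fin m) {A B : Set ℝ} (h : A ⊆ B) :
    I.sizePr i j A ≤ I.sizePr i j B :=
  I.sizeExp_mono fun s _ => by
    by_cases hA : s ∈ A
    · simp [hA, h hA]
    · simp only [hA, if_false]; split_ifs <;> norm_num

theorem sizePr_Iic_add_Ioi (i : Fin n) (j : Fin m) (b : ℝ) :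
    I.sizePr i j (Set.Iic b) + I.sizePr i j (Set.Ioi b) = 1 := by
  rw [sizePr, sizePr, ← sizeExp_add]
  refine Eq.trans ?_ (I.sizeExp_const i j 1)
  congr 1
  ext s
  by_cases h : s ≤ b
  · simp [h]
  · simp [h, not_le.mp h]

theorem sizeExp_ite_le (i : Fin n) (j : Fin m) (b c : ℝ) :
    I.sizeExp i j (fun s => if s ≤ b then c else 0) = c * I.sizePr i j (Set.Iic b) := by
  rw [sizePr, ← sizeExp_const_mul]
  congr 1
  ext s
  by_cases h : s ≤ b <;> simp [h]

theorem mu_nonneg {t : ℝ} (ht : 0 ≤ t) (i : Fin n) (j : Fin m) : 0 ≤ I.mu t i j :=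
  I.const_le_sizeExp fun _ hs => le_min hs ht

theorem mu_le (t : ℝ) (i : Fin n) (j : Fin m) : I.mu t i j ≤ t :=
  I.sizeExp_le_const fun _ _ => min_le_right _ _

theorem mu'_nonneg {t : ℝ} (ht : 0 ≤ t) (i : Fin n) (j : Option (Fin m)) : 0 ≤ I.mu' t i j := by
  cases j
  · exact le_rfl
  · exact I.mu_nonneg ht i _

theorem mu'_le {t : ℝ} (ht : 0 ≤ t) (i : Fin n) (j : Option (Fin m)) : I.mu' t i j ≤ t := by
  cases j
  · exact ht
  · exact I.mu_le t i _

/-! ### Feasible and optimal solutions of the linear program -/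

theorem le_one_of_lpFeasible {t : ℝ} {x : Fin n → Option (Fin m) → ℝ} (hx : x ∈ I.lpFeasible t)
    (i : Fin n) (j : Option (Fin m)) : x i j ≤ 1 := by
  rw [← hx.2.1 i]
  exact Finset.single_le_sum (fun j _ => hx.2.2 i j) (Finset.mem_univ j)

theorem isCompact_lpFeasible (t : ℝ) : IsCompact (I.lpFeasible t) := by
  have hK : IsCompact (Set.univ.pi fun _ : Fin n => Set.univ.pi fun _ : Option (Fin m) =>
      Set.Icc (0 : ℝ) 1) :=
    isCompact_univ_pi fun _ => isCompact_univ_pi fun _ => isCompact_Icc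
  refine hK.of_isClosed_subset ?_ fun x hx i _ j _ =>
    ⟨hx.2.2 i j, I.le_one_of_lpFeasible hx i j⟩
  simp only [lpFeasible, Set.ofPred_and, Set.ofPred_forall]
  refine IsClosed.inter (isClosed_le (by fun_prop) (by fun_prop)) (IsClosed.inter ?_ ?_)
  · exact isClosed_iInter fun i => isClosed_eq (by fun_prop) (by fun_prop)
  · exact isClosed_iInter fun i => isClosed_iInter fun j => isClosed_le (by fun_prop) (by fun_prop)

theorem continuous_lpValue : Continuous I.lpValue := by
  unfold lpValue
  fun_prop

theorem lpValue_le_Phi {t : ℝ} {x : Fin n → Option (Fin m) → ℝ} (hx : x ∈ I.lpFeasible t) :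
    I.lpValue x ≤ I.Phi t :=
  le_csSup ((I.isCompact_lpFeasible t).image I.continuous_lpValue).bddAbove ⟨x, hx, rfl⟩

theorem Phi_eq_of_optimal {t : ℝ} {x : Fin n → Option (Fin m) → ℝ} (hx : x ∈ I.lpFeasible t)
    (h : ∀ y ∈ I.lpFeasible t, I.lpValue y ≤ I.lpValue x) : I.Phi t = I.lpValue x :=
  le_antisymm (csSup_le ⟨_, x, hx, rfl⟩ (by rintro _ ⟨y, hy, rfl⟩; exact h y hy))
    (I.lpValue_le_Phi hx)

/-- A fractional selection of pairs, with at most one choice in total for each item, is completed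
to a feasible solution by null choices. -/
def complete (y : Fin n → Fin m → ℝ) (i : Fin n) : Option (Fin m) → ℝ
  | none => 1 - ∑ j, y i j
  | some j => y i j

theorem complete_mem_lpFeasible {t : ℝ} {y : Fin n → Fin m → ℝ} (h0 : ∀ i j, 0 ≤ y i j)
    (h1 : ∀ i, ∑ j, y i j ≤ 1) (ht : ∑ i, ∑ j, I.mu t i j * y i j ≤ t) :
    complete y ∈ I.lpFeasible t := by
  refine ⟨?_, fun i => ?_, fun i j => ?_⟩
  · simpa [Fintype.sum_option, mu', complete] using ht
  · simp [Fintype.sum_option, complete]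
  · cases j
    · exact sub_nonneg.mpr (h1 i)
    · exact h0 i _

theorem lpValue_complete (y : Fin n → Fin m → ℝ) :
    I.lpValue (complete y) = ∑ i, ∑ j, I.w i j * y i j := by
  simp [lpValue, Fintype.sum_option, w', complete]

theorem sum_le_Phi {t : ℝ} {y : Fin n → Fin m → ℝ} (h0 : ∀ i j, 0 ≤ y i j)
    (h1 : ∀ i, ∑ j, y i j ≤ 1) (ht : ∑ i, ∑ j, I.mu t i j * y i j ≤ t) :
    ∑ i, ∑ j, I.w i j * y i j ≤ I.Phi t :=
  I.lpValue_complete y ▸ I.lpValue_le_Phi (I.complete_mem_lpFeasible h0 h1 ht)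

theorem Phi_nonneg {t : ℝ} (ht : 0 ≤ t) : 0 ≤ I.Phi t := by
  simpa using I.sum_le_Phi (t := t) (y := fun _ _ => 0) (by simp) (by simp) (by simpa using ht)

/-- Truncation at `t` makes every single choice fit into the budget `t` of the linear program. -/
theorem w_le_Phi (t : ℝ) (i : Fin n) (j : Fin m) : I.w i j ≤ I.Phi t := by
  have key : ∀ f : Fin n → Fin m → ℝ,
      ∑ i', ∑ j', f i' j' * (if i' = i then if j' = j then (1 : ℝ) else 0 else 0) = f i j := by
    intro f
    rw [Finset.sum_eq_single i (fun k _ hk => by simp [hk]) (by simp)]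
    simp
  have := I.sum_le_Phi (t := t)
    (y := fun i' j' => if i' = i then if j' = j then (1 : ℝ) else 0 else 0)
    (fun i' j' => by split_ifs <;> norm_num)
    (fun i' => by by_cases h : i' = i <;> simp [h])
    (by rw [key]; exact I.mu_le t i j)
  rwa [key] at this

theorem w'_le_Phi {t : ℝ} (ht : 0 ≤ t) (i : Fin n) (j : Option (Fin m)) :
    I.w' i j ≤ I.Phi t := by
  cases j
  · exact I.Phi_nonneg ht
  · exact I.w_le_Phi t i _

theorem IsStructuredOptimal.Phi_eq {t : ℝ} {x : Fin n → Option (Fin m) → ℝ}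
    (hx : I.IsStructuredOptimal t x) : I.Phi t = ∑ i, I.candW x i :=
  I.Phi_eq_of_optimal hx.feasible hx.optimal

/-- A choice that is used by an optimal solution has nonnegative expected net profit. -/
theorem w'_nonneg_of_pos {t : ℝ} (ht : 0 ≤ t) {x : Fin n → Option (Fin m) → ℝ}
    (hx : x ∈ I.lpFeasible t) (h : ∀ y ∈ I.lpFeasible t, I.lpValue y ≤ I.lpValue x)
    {i : Fin n} {j : Option (Fin m)} (hj : 0 < x i j) : 0 ≤ I.w' i j := by
  obtain _ | j := j
  · exact le_rfl
  have key : ∀ f : Fin n → Fin m → ℝ,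
      ∑ i', ∑ j', f i' j' * (if i' = i ∧ j' = j then 0 else x i' (some j')) =
        ∑ i', ∑ j', f i' j' * x i' (some j') - f i j * x i (some j) := by
    intro f
    have h2 : f i j * x i (some j) = ∑ i', ∑ j',
        if i' = i ∧ j' = j then f i' j' * x i' (some j') else 0 := by
      rw [Finset.sum_eq_single i (fun k _ hk => by simp [hk]) (by simp)]
      simp
    rw [h2, ← Finset.sum_sub_distrib]
    refine Finset.sum_congr rfl fun i' _ => ?_
    rw [← Finset.sum_sub_distrib]
    refine Finset.sum_congr rfl fun j' _ => ?_
    split_ifs <;> simp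
  have hxs : ∀ f : Fin n → Option (Fin m) → ℝ, (∀ i, f i none = 0) →
      ∑ i', ∑ j', f i' j' * x i' j' = ∑ i', ∑ j', f i' (some j') * x i' (some j') := by
    intro f hf
    simp [Fintype.sum_option, hf]
  -- Moving the weight of the choice to the null choice stays feasible, so by optimality it cannot
  -- raise the value.
  have h3 := I.sum_le_Phi (t := t)
    (y := fun i' j' => if i' = i ∧ j' = j then 0 else x i' (some j'))
    (fun i' j' => by split_ifs; exacts [le_rfl, hx.2.2 _ _])
    (fun i' => by
      rw [← hx.2.1 i', Fintype.sum_option]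
      have : ∑ j', (if i' = i ∧ j' = j then 0 else x i' (some j')) ≤ ∑ j', x i' (some j') :=
        Finset.sum_le_sum fun j' _ => by split_ifs; exacts [hx.2.2 _ _, le_rfl]
      linarith [hx.2.2 i' none])
    (by
      rw [key]
      have h4 := hx.1
      rw [hxs _ fun _ => rfl] at h4
      have h5 : 0 ≤ I.mu t i j * x i (some j) := mul_nonneg (I.mu_nonneg ht i j) hj.le
      simp only [mu'] at h4
      linarith)
  rw [key, I.Phi_eq_of_optimal hx h, lpValue, hxs _ fun _ => rfl] at h3
  simp only [w'] at h3 ⊢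
  exact nonneg_of_mul_nonneg_left (by linarith) hj

/-! ### The linear program bounds adaptive policies -/

/-- Here `y i j` is the probability that the policy selects the pair. Sizes that fit add up to at
most `b`, and the one overflowing item adds at most `t` after truncation. -/
theorem exists_selection_of_policy {t : ℝ} (ht : 0 ≤ t) (φ : AdaptivePolicy n m) (k : ℕ)
    (J : Finset (Fin n)) {b : ℝ} (hb : 0 ≤ b) (hb1 : b ≤ 1) :
    ∃ y : Fin n → Fin m → ℝ, (∀ i j, 0 ≤ y i j) ∧ (∀ i, ∑ j, y i j ≤ 1) ∧
      (∀ i ∉ J, ∀ j, y i j = 0) ∧ ∑ i, ∑ j, I.mu t i j * y i j ≤ b + t ∧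
      I.adaptiveProfitFrom φ k J b ≤ ∑ i, ∑ j, I.w i j * y i j := by
  induction k generalizing J b with
  | zero => exact ⟨0, by simp, by simp, by simp, by simp; positivity, by simp [adaptiveProfitFrom]⟩
  | succ k ih =>
    cases hn : φ.next J b with
    | none =>
      exact ⟨0, by simp, by simp, by simp, by simp; positivity, by simp [adaptiveProfitFrom, hn]⟩
    | some a =>
      obtain ⟨i, j⟩ := a
      have hi := φ.next_mem J b i j hn
      have ih' : ∀ s, ∃ y : Fin n → Fin m → ℝ, 0 ≤ s → (∀ i j, 0 ≤ y i j) ∧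
          (∀ i, ∑ j, y i j ≤ 1) ∧ (∀ i' ∉ J.erase i, ∀ j, y i' j = 0) ∧
          ∑ i', ∑ j, I.mu t i' j * y i' j ≤ (if s ≤ b then b - s + t else 0) ∧
          (if s ≤ b then I.adaptiveProfitFrom φ k (J.erase i) (b - s) else 0) ≤
            ∑ i, ∑ j, I.w i j * y i j := by
        intro s
        by_cases hs : 0 ≤ s ∧ s ≤ b
        · obtain ⟨y, hy⟩ := ih (J.erase i) (b := b - s) (by linarith) (by linarith)
          exact ⟨y, fun _ => by simpa [hs.2] using hy⟩
        -- After an overflow nothing more is selected; negative `s` are irrelevant and only make the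
        -- choice of `y` total.
        · refine ⟨0, fun h0 => ?_⟩
          have : ¬ s ≤ b := fun h => hs ⟨h0, h⟩
          simp [this]
      choose y hy using ih'
      have hlin : ∀ f : Fin n → Fin m → ℝ,
          ∑ i', ∑ j', f i' j' * ((if i' = i ∧ j' = j then 1 else 0) +
            I.sizeExp i j (fun s => y s i' j')) =
          f i j + I.sizeExp i j (fun s => ∑ i', ∑ j', f i' j' * y s i' j') := by
        intro f
        simp only [mul_add, Finset.sum_add_distrib, sizeExp_finset_sum, sizeExp_const_mul]
        congr 1
        rw [Finset.sum_eq_single i (fun k _ hk => by simp [hk]) (by simp)]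
        simp
      have hpos : ∀ i' j', 0 ≤ I.sizeExp i j (fun s => y s i' j') := fun i' j' =>
        I.const_le_sizeExp fun s hs => (hy s hs).1 i' j'
      have hzero : ∀ i', i' ∉ J.erase i → ∀ j', I.sizeExp i j (fun s => y s i' j') = 0 := by
        intro i' hi' j'
        refine Finset.sum_eq_zero fun s hs => ?_
        simp only [(hy s (I.size_nonneg i j s hs)).2.2.1 i' hi' j', mul_zero]
      -- The present selection has probability one; the later ones are averaged over its size.
      refine ⟨fun i' j' => (if i' = i ∧ j' = j then 1 else 0) +
        I.sizeExp i j (fun s => y s i' j'), fun i' j' => ?_, fun i' => ?_, fun i' hi' j' => ?_,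
        ?_, ?_⟩
      · exact add_nonneg (by split_ifs <;> norm_num) (hpos i' j')
      · by_cases h : i' = i
        · subst h
          simp [hzero i' (by simp)]
        · simp only [h, false_and, if_false, zero_add]
          rw [← sizeExp_finset_sum]
          exact I.sizeExp_le_const fun s hs => (hy s hs).2.1 i'
      · have h : i' ≠ i := fun h => hi' (h ▸ hi)
        simp [h, hzero i' (fun h' => hi' (Finset.mem_of_mem_erase h'))]
      · rw [hlin, mu, ← sizeExp_add]
        refine I.sizeExp_le_const fun s hs => ?_
        have h1 := (hy s hs).2.2.2.1
        have h2 := min_le_left s t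
        have h3 := min_le_right s t
        split_ifs at h1 <;> linarith
      · rw [hlin]
        have h1 : I.adaptiveProfitFrom φ (k + 1) J b = - I.p i j + I.sizeExp i j (fun s =>
            if s ≤ b then I.v i + I.adaptiveProfitFrom φ k (J.erase i) (b - s) else 0) := by
          simp [adaptiveProfitFrom, hn]
        have h2 : I.sizeExp i j (fun s =>
            if s ≤ b then I.v i + I.adaptiveProfitFrom φ k (J.erase i) (b - s) else 0) ≤
            I.sizeExp i j (fun s => (if s ≤ b then I.v i else 0) +
              ∑ i', ∑ j', I.w i' j' * y s i' j') :=
          I.sizeExp_mono fun s hs => by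
            have h3 := (hy s hs).2.2.2.2
            split_ifs at h3 ⊢ <;> linarith
        rw [sizeExp_add, sizeExp_ite_le] at h2
        -- Measuring `w` against the full budget can only overestimate the gain with budget `b`.
        have h4 : I.v i * I.sizePr i j (Set.Iic b) ≤ I.v i * I.sizePr i j (Set.Iic 1) :=
          mul_le_mul_of_nonneg_left (I.sizePr_mono i j (Set.Iic_subset_Iic.mpr hb1))
            (I.v_nonneg i)
        rw [h1, w]
        linarith

theorem ADAPT_le_Phi {t : ℝ} (ht : 0 < t) (ht1 : t ≤ 1) : I.ADAPT ≤ 2 / t * I.Phi t := by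
  have : Nonempty (AdaptivePolicy n m) := ⟨⟨fun _ _ => none, by simp⟩⟩
  refine ciSup_le fun φ => ?_
  obtain ⟨y, h0, h1, -, h2, h3⟩ :=
    I.exists_selection_of_policy ht.le φ n Finset.univ zero_le_one le_rfl
  have hs : ∀ f : Fin n → Fin m → ℝ, ∑ i, ∑ j, f i j * (t / 2 * y i j) =
      t / 2 * ∑ i, ∑ j, f i j * y i j := by
    intro f
    simp only [Finset.mul_sum]
    exact Finset.sum_congr rfl fun i _ => Finset.sum_congr rfl fun j _ => by ring
  have h4 := I.sum_le_Phi (t := t) (y := fun i j => t / 2 * y i j)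
    (fun i j => mul_nonneg (by positivity) (h0 i j))
    (fun i => by
      rw [← Finset.mul_sum]
      have := Finset.sum_nonneg fun j (_ : j ∈ Finset.univ) => h0 i j
      nlinarith [h1 i])
    (by rw [hs]; nlinarith)
  rw [hs] at h4
  calc I.adaptiveProfit φ ≤ ∑ i, ∑ j, I.w i j * y i j := h3
    _ = 2 / t * (t / 2 * ∑ i, ∑ j, I.w i j * y i j) := by field_simp
    _ ≤ _ := mul_le_mul_of_nonneg_left h4 (by positivity)

/-! ### Existence of a structured optimal solution and of a run -/

open Classical in
/-- The positive entries of a solution. -/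
def posEntries (x : Fin n → Option (Fin m) → ℝ) : Finset (Fin n × Option (Fin m)) :=
  Finset.univ.filter fun e => 0 < x e.1 e.2

theorem mem_posEntries {x : Fin n → Option (Fin m) → ℝ} {e : Fin n × Option (Fin m)} :
    e ∈ posEntries x ↔ 0 < x e.1 e.2 := by
  simp [posEntries]

/-- A solution with more than `n + 1` positive entries can be moved in a nonzero direction that
keeps the constraints tight and does not decrease the value. -/
theorem exists_direction (t : ℝ) {x : Fin n → Option (Fin m) → ℝ}
    (hx : n + 1 < (posEntries x).card) :
    ∃ d : Fin n → Option (Fin m) → ℝ, (∃ i j, d i j ≠ 0) ∧ (∀ i j, d i j ≠ 0 → 0 < x i j) ∧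
      (∀ i, ∑ j, d i j = 0) ∧ ∑ i, ∑ j, I.mu' t i j * d i j = 0 ∧ 0 ≤ I.lpValue d := by
  classical
  let E : (posEntries x → ℝ) →ₗ[ℝ] (Fin n → Option (Fin m) → ℝ) :=
    { toFun := fun c i j => if h : (i, j) ∈ posEntries x then c ⟨(i, j), h⟩ else 0
      map_add' := fun a b => by
        ext i j
        by_cases h : (i, j) ∈ posEntries x <;> simp [h]
      map_smul' := fun r a => by
        ext i j
        by_cases h : (i, j) ∈ posEntries x <;> simp [h] }
  let F : (Fin n → Option (Fin m) → ℝ) →ₗ[ℝ] (Fin n → ℝ) × ℝ :=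
    { toFun := fun d => (fun i => ∑ j, d i j, ∑ i, ∑ j, I.mu' t i j * d i j)
      map_add' := fun a b => by
        ext <;> simp [Finset.sum_add_distrib, mul_add]
      map_smul' := fun r a => by
        ext
        · simp [Finset.mul_sum, mul_add]
        · simp only [Pi.smul_apply, smul_eq_mul, Prod.smul_snd, Finset.mul_sum, RingHom.id_apply]
          exact Finset.sum_congr rfl fun i _ => Finset.sum_congr rfl fun j _ => by ring }
  -- There are `n` row sums and one size constraint against more than `n + 1` free entries.
  have hker : LinearMap.ker (F ∘ₗ E) ≠ ⊥ := by
    apply LinearMap.ker_ne_bot_of_finrank_lt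
    simpa using hx
  obtain ⟨c, hc, hc0⟩ := (Submodule.ne_bot_iff _).mp hker
  have hF : F (E c) = 0 := hc
  have h1 : ∀ i, ∑ j, E c i j = 0 := fun i => congrFun (congrArg Prod.fst hF) i
  have h2 : ∑ i, ∑ j, I.mu' t i j * E c i j = 0 := congrArg Prod.snd hF
  have h3 : ∀ i j, E c i j ≠ 0 → 0 < x i j := by
    intro i j h
    by_contra hn
    exact h (dif_neg fun hm => hn (mem_posEntries.mp hm))
  have h4 : ∃ i j, E c i j ≠ 0 := by
    obtain ⟨⟨⟨i, j⟩, he⟩, hi⟩ := Function.ne_iff.mp hc0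
    exact ⟨i, j, by simpa [E, he] using hi⟩
  rcases le_total 0 (I.lpValue (E c)) with h | h
  · exact ⟨E c, h4, h3, h1, h2, h⟩
  · refine ⟨-E c, by simpa using h4, by simpa using h3, ?_, ?_, ?_⟩
    · simpa [-Fintype.sum_option] using h1
    · simpa [-Fintype.sum_option] using h2
    · simpa [lpValue, -Fintype.sum_option] using h

theorem lpValue_add_smul (x d : Fin n → Option (Fin m) → ℝ) (r : ℝ) :
    I.lpValue (fun i j => x i j + r * d i j) = I.lpValue x + r * I.lpValue d := by
  simp only [lpValue, mul_add, Finset.sum_add_distrib, Finset.mul_sum]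
  congr 1
  exact Finset.sum_congr rfl fun i _ => Finset.sum_congr rfl fun j _ => by ring

/-- A feasible solution with more than `n + 1` positive entries can be replaced by one with fewer
positive entries and at least the same value. -/
theorem exists_smaller_support {t : ℝ} {x : Fin n → Option (Fin m) → ℝ}
    (hx : x ∈ I.lpFeasible t) (hc : n + 1 < (posEntries x).card) :
    ∃ y ∈ I.lpFeasible t, I.lpValue x ≤ I.lpValue y ∧
      (posEntries y).card < (posEntries x).card := by
  classical
  obtain ⟨d, ⟨i₀, j₀, h0⟩, hsupp, hd1, hd2, hd3⟩ := I.exists_direction t hc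
  let N : Finset (Fin n × Option (Fin m)) := Finset.univ.filter fun e => d e.1 e.2 < 0
  -- A nonzero row with sum zero has a negative entry.
  have hN : N.Nonempty := by
    by_contra hN
    have hd : ∀ j ∈ Finset.univ, 0 ≤ d i₀ j := fun j _ => by
      by_contra h
      exact hN ⟨(i₀, j), by simpa [N] using h⟩
    exact h0 ((Finset.sum_eq_zero_iff_of_nonneg hd).mp (hd1 i₀) j₀ (Finset.mem_univ _))
  -- Ratio test: `r` is the step length at which a decreasing entry first reaches zero.
  obtain ⟨⟨i₁, j₁⟩, he, hmin⟩ := N.exists_min_image (fun e => x e.1 e.2 / (-d e.1 e.2)) hN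
  have hneg : d i₁ j₁ < 0 := by simpa [N] using he
  set r := x i₁ j₁ / (-d i₁ j₁) with hr
  have hr0 : 0 ≤ r := div_nonneg (hx.2.2 _ _) (by linarith)
  have hy0 : ∀ i j, 0 ≤ x i j + r * d i j := by
    intro i j
    by_cases h : d i j < 0
    · have h1 : r ≤ x i j / (-d i j) := hmin (i, j) (by simpa [N] using h)
      rw [le_div_iff₀ (by linarith)] at h1
      linarith
    · exact add_nonneg (hx.2.2 i j) (mul_nonneg hr0 (not_lt.mp h))
  have hy1 : x i₁ j₁ + r * d i₁ j₁ = 0 := by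
    have : d i₁ j₁ ≠ 0 := hneg.ne
    rw [hr]
    field_simp
    ring
  refine ⟨fun i j => x i j + r * d i j, ⟨?_, fun i => ?_, hy0⟩, ?_, ?_⟩
  · have : ∑ i, ∑ j, I.mu' t i j * (x i j + r * d i j) =
        ∑ i, ∑ j, I.mu' t i j * x i j + r * ∑ i, ∑ j, I.mu' t i j * d i j := by
      simp only [mul_add, Finset.sum_add_distrib, Finset.mul_sum]
      congr 1
      exact Finset.sum_congr rfl fun i _ => Finset.sum_congr rfl fun j _ => by ring
    rw [this, hd2, mul_zero, add_zero]
    exact hx.1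
  · rw [Finset.sum_add_distrib, ← Finset.mul_sum, hd1, hx.2.1 i, mul_zero, add_zero]
  · rw [lpValue_add_smul]
    exact le_add_of_nonneg_right (mul_nonneg hr0 hd3)
  · refine Finset.card_lt_card ((Finset.ssubset_iff_of_subset fun e he => ?_).mpr
      ⟨(i₁, j₁), mem_posEntries.mpr (hsupp _ _ hneg.ne), fun h => ?_⟩)
    · rw [mem_posEntries] at he ⊢
      by_cases h : d e.1 e.2 = 0
      · simpa [h] using he
      · exact hsupp _ _ h
    · exact (mem_posEntries.mp h).ne' hy1

theorem ncard_pos_eq_card_filter (x : Fin n → Option (Fin m) → ℝ) (i : Fin n) :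
    {j | 0 < x i j}.ncard = ((posEntries x).filter fun e => e.1 = i).card := by
  classical
  rw [← Set.ncard_coe_finset, ← Set.ncard_image_of_injective _ (Prod.mk_right_injective i)]
  congr 1
  ext ⟨i', j⟩
  simp only [Set.mem_image, Set.mem_ofPred_eq, Prod.mk.injEq, Finset.coe_filter, mem_posEntries]
  constructor
  · rintro ⟨j', h, rfl, rfl⟩
    exact ⟨h, rfl⟩
  · rintro ⟨h, rfl⟩
    exact ⟨j, h, rfl, rfl⟩

theorem card_posEntries (x : Fin n → Option (Fin m) → ℝ) :
    (posEntries x).card = ∑ i, {j | 0 < x i j}.ncard := by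
  classical
  simp only [ncard_pos_eq_card_filter]
  exact Finset.card_eq_sum_card_fiberwise fun _ _ => Finset.mem_univ _

theorem one_le_ncard_pos {t : ℝ} {x : Fin n → Option (Fin m) → ℝ} (hx : x ∈ I.lpFeasible t)
    (i : Fin n) : 1 ≤ {j | 0 < x i j}.ncard := by
  rw [Nat.one_le_iff_ne_zero, Ne, Set.ncard_eq_zero]
  intro h
  have h1 : ∑ j, x i j = 0 := Finset.sum_eq_zero fun j _ =>
    le_antisymm (not_lt.mp fun hj => (h ▸ hj : j ∈ (∅ : Set (Option (Fin m))))) (hx.2.2 i j)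
  linarith [hx.2.1 i]

/-- An optimal solution with fewest positive entries has at most `n + 1` of them. Every item needs
one, so only one item can have a second. -/
theorem exists_structuredOptimal {t : ℝ} (ht : 0 ≤ t) : ∃ x, I.IsStructuredOptimal t x := by
  classical
  have hne : (I.lpFeasible t).Nonempty :=
    ⟨_, I.complete_mem_lpFeasible (y := fun _ _ => 0) (by simp) (by simp) (by simpa using ht)⟩
  obtain ⟨x₀, hx₀, hopt₀⟩ :=
    (I.isCompact_lpFeasible t).exists_isMaxOn hne I.continuous_lpValue.continuousOn
  let O : Set (Fin n → Option (Fin m) → ℝ) :=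
    {x | x ∈ I.lpFeasible t ∧ ∀ y ∈ I.lpFeasible t, I.lpValue y ≤ I.lpValue x}
  obtain ⟨x, ⟨hx, hopt⟩, hmin⟩ :=
    (measure fun x : Fin n → Option (Fin m) → ℝ => (posEntries x).card).wf.has_min O
      ⟨x₀, hx₀, fun y hy => hopt₀ hy⟩
  have hcard : (posEntries x).card ≤ n + 1 := by
    by_contra h
    obtain ⟨y, hy, hxy, hlt⟩ := I.exists_smaller_support hx (not_le.mp h)
    exact hmin y ⟨hy, fun z hz => (hopt z hz).trans hxy⟩ hlt
  rw [card_posEntries] at hcard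
  have hsum : ∀ s : Finset (Fin n), ∑ i ∈ s, ({j | 0 < x i j}.ncard - 1) ≤ 1 := by
    intro s
    have h1 : ∑ i, ({j | 0 < x i j}.ncard - 1) + n = ∑ i, {j | 0 < x i j}.ncard := by
      calc _ = ∑ i, ({j | 0 < x i j}.ncard - 1) + ∑ _i : Fin n, 1 := by simp
        _ = _ := by
          rw [← Finset.sum_add_distrib]
          exact Finset.sum_congr rfl fun i _ => Nat.sub_add_cancel (I.one_le_ncard_pos hx i)
    have h2 := Finset.sum_le_sum_of_subset (f := fun i => {j | 0 < x i j}.ncard - 1)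
      (Finset.subset_univ s)
    omega
  refine ⟨x, hx, hopt, fun i => ?_, fun i i' hi hi' => ?_⟩
  · have := hsum {i}
    rw [Finset.sum_singleton] at this
    omega
  · by_contra hne
    have := hsum {i, i'}
    rw [Finset.sum_pair hne] at this
    omega

theorem candW_nonneg {t : ℝ} (ht : 0 ≤ t) {x : Fin n → Option (Fin m) → ℝ}
    (hx : I.IsStructuredOptimal t x) (i : Fin n) : 0 ≤ I.candW x i := by
  refine Finset.sum_nonneg fun j _ => ?_
  rcases (hx.feasible.2.2 i j).eq_or_lt with h | h
  · simp [← h]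
  · exact mul_nonneg (I.w'_nonneg_of_pos ht hx.feasible hx.optimal h) h.le

theorem candMu_nonneg {t : ℝ} (ht : 0 ≤ t) {x : Fin n → Option (Fin m) → ℝ}
    (hx : x ∈ I.lpFeasible t) (i : Fin n) : 0 ≤ I.candMu t x i :=
  Finset.sum_nonneg fun j _ => mul_nonneg (I.mu'_nonneg ht i j) (hx.2.2 i j)

/-- Sorting by `a / (a + b)` is sorting by the density `a / b`, also if some `a` or `b` vanish. -/
theorem exists_density_order {a b : Fin n → ℝ} (ha : ∀ i, 0 ≤ a i) (hb : ∀ i, 0 ≤ b i) :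
    ∃ l : List (Fin n), l.Nodup ∧ (∀ i, i ∈ l) ∧
      l.Pairwise fun i k => a k * b i ≤ a i * b k := by
  classical
  let key : Fin n → ℝ := fun i => a i / (a i + b i)
  let r : Fin n → Fin n → Prop := fun i k => key k ≤ key i
  have : Std.Total r := ⟨fun i k => le_total _ _⟩
  have : IsTrans (Fin n) r := ⟨fun i k l h1 h2 => le_trans h2 h1⟩
  refine ⟨(List.finRange n).insertionSort r,
    (List.perm_insertionSort r _).nodup_iff.mpr (List.nodup_finRange n), fun i => by simp,
    (List.pairwise_insertionSort r _).imp fun {i k} h => ?_⟩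
  rcases (add_nonneg (ha i) (hb i)).eq_or_lt with hi | hi
  · have h1 : a i = 0 := by linarith [ha i, hb i]
    have h2 : b i = 0 := by linarith [ha i, hb i]
    simp [h1, h2]
  rcases (add_nonneg (ha k) (hb k)).eq_or_lt with hk | hk
  · have h1 : a k = 0 := by linarith [ha k, hb k]
    have h2 : b k = 0 := by linarith [ha k, hb k]
    simp [h1, h2]
  have h' : a k / (a k + b k) ≤ a i / (a i + b i) := h
  rw [div_le_div_iff₀ hk hi] at h'
  linarith

theorem nonempty_SKCRun {t : ℝ} (ht : 0 ≤ t) : Nonempty (I.SKCRun t) := by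
  obtain ⟨x, hx⟩ := I.exists_structuredOptimal ht
  by_cases h : ∃ i, I.Phi t / 4 < I.candW x i
  · obtain ⟨i, hi⟩ := h
    have : Nonempty (Fin n) := ⟨i⟩
    obtain ⟨k, hk⟩ := Finite.exists_max (I.candW x)
    exact ⟨⟨x, hx, [k], List.nodup_singleton k, Or.inl ⟨k, hi.trans_le (hk i), hk, rfl⟩⟩⟩
  · obtain ⟨l, h1, h2, h3⟩ :=
      exists_density_order (I.candW_nonneg ht hx) (I.candMu_nonneg ht hx.feasible)
    exact ⟨⟨x, hx, l, h1, Or.inr ⟨fun i => not_lt.mp fun hi => h ⟨i, hi⟩, h2, h3⟩⟩⟩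

/-! ### Averaging over the random choices -/

/-- The expectation of `f κ`, where `κ i = j` with probability `x i j`, independently for all
items `i`. -/
def choiceAvg (x : Fin n → Option (Fin m) → ℝ) (f : (Fin n → Option (Fin m)) → ℝ) : ℝ :=
  ∑ κ : Fin n → Option (Fin m), (∏ i, x i (κ i)) * f κ

section choiceAvg

variable {x : Fin n → Option (Fin m) → ℝ}

theorem choiceAvg_const (hx : ∀ i, ∑ j, x i j = 1) (c : ℝ) : choiceAvg x (fun _ => c) = c := by
  have h := Finset.prod_univ_sum (fun _ : Fin n => (Finset.univ : Finset (Option (Fin m)))) x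
  simp only [hx, Finset.prod_const_one, Fintype.piFinset_univ] at h
  rw [choiceAvg, ← Finset.sum_mul, ← h, one_mul]

theorem choiceAvg_add (f g : (Fin n → Option (Fin m)) → ℝ) :
    choiceAvg x (fun κ => f κ + g κ) = choiceAvg x f + choiceAvg x g := by
  simp only [choiceAvg, mul_add, Finset.sum_add_distrib]

theorem choiceAvg_sizeExp (i : Fin n) (j : Fin m) (f : (Fin n → Option (Fin m)) → ℝ → ℝ) :
    choiceAvg x (fun κ => I.sizeExp i j (f κ)) =
      I.sizeExp i j (fun s => choiceAvg x (fun κ => f κ s)) := by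
  simp only [choiceAvg, sizeExp, Finset.mul_sum]
  rw [Finset.sum_comm]
  exact Finset.sum_congr rfl fun s _ => Finset.sum_congr rfl fun κ _ => by ring

/-- Drawing the choice of item `i` first. -/
theorem choiceAvg_update (hx : ∀ i, ∑ j, x i j = 1) (i : Fin n)
    (f : (Fin n → Option (Fin m)) → ℝ) :
    choiceAvg x f = ∑ j, x i j * choiceAvg x (fun κ => f (Function.update κ i j)) := by
  classical
  have hprod : ∀ (κ : Fin n → Option (Fin m)) (j : Option (Fin m)),
      x i (κ i) * ∏ k, x k (Function.update κ i j k) = x i j * ∏ k, x k (κ k) := by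
    intro κ j
    rw [← Finset.mul_prod_erase _ _ (Finset.mem_univ i),
      ← Finset.mul_prod_erase _ (fun k => x k (κ k)) (Finset.mem_univ i), Function.update_self,
      Finset.prod_congr rfl fun k hk => by
        rw [Function.update_of_ne (Finset.ne_of_mem_erase hk)]]
    ring
  -- Swapping `κ i` with an independent fresh copy of it preserves the product weight.
  have hinv : Function.Involutive fun a : Option (Fin m) × (Fin n → Option (Fin m)) =>
      (a.2 i, Function.update a.2 i a.1) := fun a => by simp
  calc choiceAvg x f = ∑ j, x i j * choiceAvg x f := by rw [← Finset.sum_mul, hx, one_mul]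
    _ = ∑ a : Option (Fin m) × (Fin n → Option (Fin m)),
        x i a.1 * (∏ k, x k (a.2 k)) * f a.2 := by
      simp only [choiceAvg, Finset.mul_sum, Fintype.sum_prod_type, mul_assoc]
    _ = ∑ a : Option (Fin m) × (Fin n → Option (Fin m)),
        x i a.1 * (∏ k, x k (a.2 k)) * f (Function.update a.2 i a.1) := by
      rw [← Equiv.sum_comp hinv.toPerm]
      refine Finset.sum_congr rfl fun a _ => ?_
      simp only [Function.Involutive.coe_toPerm, hprod]
    _ = _ := by simp only [choiceAvg, Finset.mul_sum, Fintype.sum_prod_type, mul_assoc]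

end choiceAvg

/-- The expected profit of the bounded algorithm from the remaining items, when the total size of
the selected items is `T`, and the choice of an item is drawn when it is attempted. -/
def mixedProfit (δ : ℝ) (x : Fin n → Option (Fin m) → ℝ) : List (Fin n) → ℝ → ℝ
  | [], _ => 0
  | i :: l, T =>
    if δ < T then 0 else
      x i none * mixedProfit δ x l T + ∑ j, x i (some j) * (- I.p i j + I.sizeExp i j (fun s =>
        if s ≤ 1 - T then I.v i + mixedProfit δ x l (T + s) else 0))

theorem stoppingProfitFrom_of_halt {halt : List ℝ → Prop} (l : List (Fin n × Fin m)) {h : List ℝ}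
    (hh : halt h) (b : ℝ) : I.stoppingProfitFrom halt l h b = 0 := by
  cases l <;> simp [stoppingProfitFrom, hh]

/-- Choices of distinct items are independent, so each may be drawn only when needed; the halting
rule and the budget see the history only through its sum. -/
theorem choiceAvg_stoppingProfitFrom (δ : ℝ) {x : Fin n → Option (Fin m) → ℝ}
    (hx : ∀ i, ∑ j, x i j = 1) (l : List (Fin n)) (hl : l.Nodup) (h : List ℝ) :
    choiceAvg x (fun κ => I.stoppingProfitFrom (fun h => δ < h.sum)
      (l.filterMap fun i => (κ i).map fun j => (i, j)) h (1 - h.sum)) =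
      I.mixedProfit δ x l h.sum := by
  induction l generalizing h with
  | nil => simpa [mixedProfit, stoppingProfitFrom] using choiceAvg_const hx 0
  | cons i l ih =>
    obtain ⟨hi, hl⟩ := List.nodup_cons.mp hl
    by_cases hh : δ < h.sum
    · simp only [stoppingProfitFrom_of_halt (halt := fun h => δ < h.sum) I _ hh, mixedProfit, hh,
        if_true]
      exact choiceAvg_const hx 0
    · have hupd : ∀ (κ : Fin n → Option (Fin m)) (j : Option (Fin m)),
          l.filterMap (fun k => (Function.update κ i j k).map fun j => (k, j)) =
            l.filterMap (fun k => (κ k).map fun j => (k, j)) := fun κ j =>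
        List.filterMap_congr fun k hk => by
          rw [Function.update_of_ne (show k ≠ i from fun h => hi (h ▸ hk))]
      rw [choiceAvg_update hx i, Fintype.sum_option]
      simp only [List.filterMap_cons, Function.update_self, Option.map_none, Option.map_some, hupd,
        mixedProfit, hh, if_false, stoppingProfitFrom, ih hl]
      congr 1
      refine Finset.sum_congr rfl fun j _ => ?_
      rw [choiceAvg_add, choiceAvg_const hx, choiceAvg_sizeExp]
      congr 3
      ext s
      split_ifs
      · rw [choiceAvg_add, choiceAvg_const hx, ← add_comm s, ← List.sum_cons, ← ih hl,
          List.sum_cons, sub_add_eq_sub_sub_swap]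
      · exact choiceAvg_const hx 0

theorem SKCRun.boundProfit_eq {I : MSKC n m} {δ : ℝ} (R : I.SKCRun δ) :
    R.boundProfit = I.mixedProfit δ R.x R.items 0 := by
  have := I.choiceAvg_stoppingProfitFrom δ R.structured.feasible.2.1 R.items R.nodup []
  simpa [choiceAvg, SKCRun.boundProfit, stoppingProfit, SKCRun.boundPolicy] using this

/-- Attempting a single item gives its full expected net profit. -/
theorem mixedProfit_singleton {δ : ℝ} (hδ : 0 ≤ δ) (x : Fin n → Option (Fin m) → ℝ) (i : Fin n) :
    I.mixedProfit δ x [i] 0 = I.candW x i := by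
  simp only [mixedProfit, not_lt.mpr hδ, if_false, mul_zero, zero_add, add_zero, sub_zero, candW,
    Fintype.sum_option, w', zero_mul, sizeExp_ite_le, w]
  exact Finset.sum_congr rfl fun j _ => by ring

/-! ### A lower bound from affine bounds on the gains -/

/-- The sum of `f i * g k` over all pairs `i, k` where `i` stands before `k` in the list. -/
def pairSum (f g : Fin n → ℝ) : List (Fin n) → ℝ
  | [] => 0
  | i :: l => f i * (l.map g).sum + pairSum f g l

/-- By the order, each term `f i * g k` with `i` before `k` is at most its mirror image `f k * g i`.
Both together with the diagonal make up the full product. -/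
theorem two_mul_pairSum_le {f g : Fin n → ℝ} {l : List (Fin n)}
    (hl : l.Pairwise fun i k => g k * f i ≤ g i * f k) :
    2 * pairSum f g l ≤ (l.map f).sum * (l.map g).sum - (l.map fun i => f i * g i).sum := by
  induction l with
  | nil => simp [pairSum]
  | cons i l ih =>
    obtain ⟨h1, h2⟩ := List.pairwise_cons.mp hl
    have h3 : (l.map fun k => g k * f i).sum ≤ (l.map fun k => g i * f k).sum :=
      List.sum_le_sum h1
    rw [List.sum_map_mul_right, List.sum_map_mul_left] at h3
    simp only [pairSum, List.map_cons, List.sum_cons]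
    linarith [ih h2]

/-- If the gain of choice `j` of item `i` in a knapsack that is filled up to `T ≤ δ` is at least
`a i j - b i j * T`, and this is nonpositive at `T = δ`, then the bounded algorithm earns at least
what these bounds give for the expected (truncated) total sizes. -/
theorem mixedProfit_ge {δ : ℝ} (hδ : 0 ≤ δ) (hδ1 : δ ≤ 1) {x : Fin n → Option (Fin m) → ℝ}
    (hx : x ∈ I.lpFeasible δ) {a b : Fin n → Fin m → ℝ}
    (hb : ∀ i j, 0 < x i (some j) → 0 ≤ b i j)
    (hab : ∀ i j, 0 < x i (some j) → a i j ≤ b i j * δ)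
    (hgain : ∀ i j T, 0 < x i (some j) → 0 ≤ T → T ≤ δ →
      a i j - b i j * T ≤ I.v i * I.sizePr i j (Set.Iic (1 - T)) - I.p i j)
    (l : List (Fin n)) {T : ℝ} (hT : 0 ≤ T) :
    (l.map fun i => ∑ j, x i (some j) * a i j).sum
      - (l.map fun i => ∑ j, x i (some j) * b i j).sum * T
      - pairSum (I.candMu δ x) (fun i => ∑ j, x i (some j) * b i j) l ≤
    I.mixedProfit δ x l T := by
  set A : Fin n → ℝ := fun i => ∑ j, x i (some j) * a i j with hA
  set B : Fin n → ℝ := fun i => ∑ j, x i (some j) * b i j with hB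
  have hmul : ∀ i j {y z : ℝ}, (0 < x i (some j) → y ≤ z) →
      x i (some j) * y ≤ x i (some j) * z := by
    intro i j y z h
    rcases (hx.2.2 i (some j)).eq_or_lt with h0 | h0
    · simp [← h0]
    · exact mul_le_mul_of_nonneg_left (h h0) h0.le
  have hB0 : ∀ i, 0 ≤ B i := fun i => Finset.sum_nonneg fun j _ => by
    simpa using hmul i j (hb i j)
  have hABδ : ∀ i, A i ≤ B i * δ := fun i => by
    simp only [hA, hB, Finset.sum_mul, mul_assoc]
    exact Finset.sum_le_sum fun j _ => hmul i j (hab i j)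
  have hM : ∀ i, 0 ≤ I.candMu δ x i := I.candMu_nonneg hδ hx
  have hsum0 : ∀ l : List (Fin n), 0 ≤ (l.map B).sum := fun l =>
    List.sum_nonneg (by simp only [List.mem_map]; rintro _ ⟨i, -, rfl⟩; exact hB0 i)
  have hpair0 : ∀ l : List (Fin n), 0 ≤ pairSum (I.candMu δ x) B l := by
    intro l
    induction l with
    | nil => exact le_rfl
    | cons i l ih => exact add_nonneg (mul_nonneg (hM i) (hsum0 l)) ih
  -- Past `δ` the claimed bound is nonpositive, so it holds after stopping or overflow, where
  -- nothing more is earned.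
  have hfull : ∀ (l : List (Fin n)) {T : ℝ}, δ ≤ T →
      (l.map A).sum - (l.map B).sum * T - pairSum (I.candMu δ x) B l ≤ 0 := by
    intro l T hT
    have h1 : (l.map A).sum ≤ (l.map fun i => B i * δ).sum := List.sum_le_sum fun i _ => hABδ i
    rw [List.sum_map_mul_right] at h1
    have h2 := mul_le_mul_of_nonneg_left hT (hsum0 l)
    linarith [hpair0 l]
  induction l generalizing T with
  | nil => simp [pairSum, mixedProfit]
  | cons i l ih =>
    by_cases hδT : δ < T
    · rw [mixedProfit, if_pos hδT]
      exact hfull (i :: l) hδT.le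
    rw [mixedProfit, if_neg hδT]
    have hTδ := not_lt.mp hδT
    set K : ℝ := (l.map A).sum - pairSum (I.candMu δ x) B l with hK
    set S : ℝ := (l.map B).sum with hS
    have hchoice : ∀ j, 0 < x i (some j) →
        (a i j - b i j * T) + (K - S * T - S * I.mu δ i j) ≤
        - I.p i j + I.sizeExp i j (fun s =>
          if s ≤ 1 - T then I.v i + I.mixedProfit δ x l (T + s) else 0) := by
      intro j hj
      -- The bound for the rest is affine in the size; once `s` is truncated at `δ`, its expectation
      -- involves only `mu`.
      have h1 : I.sizeExp i j (fun s => (if s ≤ 1 - T then I.v i else 0) +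
          ((K - S * T) + (-S) * min s δ)) ≤ I.sizeExp i j (fun s =>
          if s ≤ 1 - T then I.v i + I.mixedProfit δ x l (T + s) else 0) := by
        refine I.sizeExp_mono fun s hs => ?_
        have hf := hfull l (T := T + min s δ)
        by_cases hsT : s ≤ 1 - T
        · rw [if_pos hsT, if_pos hsT]
          have h2 := ih (T := T + s) (by linarith)
          have h3 := mul_le_mul_of_nonneg_left (min_le_left s δ) (hsum0 l)
          rcases le_total s δ with h | h
          · rw [min_eq_left h]
            linarith
          · rw [min_eq_right h] at hf ⊢
            -- At `s = δ` and `T = 0` the algorithm has not stopped yet, so the inductive bound is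
            -- needed there.
            rcases h.eq_or_lt with rfl | h
            · linarith
            have h4 : I.mixedProfit δ x l (T + s) = 0 := by
              cases l with
              | nil => rfl
              | cons k l => rw [mixedProfit, if_pos (by linarith)]
            linarith [hf (by linarith)]
        · rw [if_neg hsT, if_neg hsT]
          have : δ ≤ T + min s δ := by
            rcases min_choice s δ with h | h <;> rw [h] <;> linarith
          linarith [hf this]
      rw [sizeExp_add, sizeExp_ite_le, sizeExp_add, sizeExp_const, sizeExp_const_mul] at h1
      have h2 := hgain i j T hj hT hTδ
      rw [mu]
      linarith
    have hnone : x i none * (K - S * T) ≤ x i none * I.mixedProfit δ x l T :=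
      mul_le_mul_of_nonneg_left (by linarith [ih hT]) (hx.2.2 i none)
    have hsome := Finset.sum_le_sum fun j (_ : j ∈ Finset.univ) => hmul i j (hchoice j)
    have hx1 : ∑ j, x i (some j) = 1 - x i none := by
      linarith [hx.2.1 i, Fintype.sum_option (x i)]
    have hcand : I.candMu δ x i = ∑ j, x i (some j) * I.mu δ i j := by
      simp [candMu, Fintype.sum_option, mu', mul_comm]
    have hexp : ∑ j, x i (some j) * ((a i j - b i j * T) + (K - S * T - S * I.mu δ i j)) =
        A i - B i * T + ((1 - x i none) * (K - S * T) - S * I.candMu δ x i) := by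
      rw [hcand, ← hx1]
      simp only [hA, hB, Finset.sum_mul, Finset.mul_sum, ← Finset.sum_sub_distrib,
        ← Finset.sum_add_distrib]
      exact Finset.sum_congr rfl fun j _ => by ring
    rw [hexp] at hsome
    simp only [List.map_cons, List.sum_cons, pairSum]
    linarith

/-! ### The gain of a single choice -/

/-- Markov's inequality: an overflow forces `T + min s δ ≥ δ`. -/
theorem sizePr_Ioi_one_sub_le {δ : ℝ} (hδ : 0 < δ) (hδ1 : δ ≤ 1) (i : Fin n) (j : Fin m) {T : ℝ}
    (hT : 0 ≤ T) :
    I.sizePr i j (Set.Ioi (1 - T)) ≤ (T + I.mu δ i j) / δ := by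
  have h : I.sizePr i j (Set.Ioi (1 - T)) ≤ I.sizeExp i j (fun s => δ⁻¹ * (T + min s δ)) := by
    refine I.sizeExp_mono fun s hs => ?_
    have hm : 0 ≤ min s δ := le_min hs hδ.le
    split_ifs with h
    · have h1 : 1 - T < s := h
      have h2 : δ ≤ T + min s δ := by
        rcases min_choice s δ with h' | h' <;> rw [h'] <;> linarith
      rw [inv_mul_eq_div]
      exact (one_le_div hδ).mpr h2
    · positivity
  rwa [sizeExp_const_mul, sizeExp_add, sizeExp_const, inv_mul_eq_div] at h

theorem w_add_p_le (i : Fin n) (j : Fin m) : I.w i j + I.p i j ≤ I.v i := by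
  have := mul_le_mul_of_nonneg_left (I.sizePr_le_one i j (Set.Iic 1)) (I.v_nonneg i)
  rw [w]
  linarith

/-- The gain of a choice of small cost, from Markov's inequality. -/
theorem gain_ge_of_cost_le {δ : ℝ} (hδ : 0 < δ) (hδ1 : δ ≤ 1) {i : Fin n} {j : Fin m} {a : ℝ}
    (ha : 0 ≤ a) (hw : 0 ≤ I.w i j) (hp : I.p i j ≤ a * I.w i j) {T : ℝ} (hT : 0 ≤ T) :
    I.w i j * (1 - (1 + a) * ((T + I.mu δ i j) / δ)) ≤
      I.v i * I.sizePr i j (Set.Iic (1 - T)) - I.p i j := by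
  have h1 := I.sizePr_Ioi_one_sub_le hδ hδ1 i j hT
  have h2 := I.sizePr_Iic_add_Ioi i j (1 - T)
  have h3 := I.sizePr_nonneg i j (Set.Iic (1 - T))
  have h4 := I.w_add_p_le i j
  have h5 := I.p_nonneg i j
  have h6 : 0 ≤ (T + I.mu δ i j) / δ :=
    div_nonneg (add_nonneg hT (I.mu_nonneg hδ.le i j)) hδ.le
  set y := (T + I.mu δ i j) / δ
  -- For `y ≥ 1` the factor `1 - y` is not positive; there the loss is at most the cost, hence at
  -- most `a * w`.
  rcases le_total y 1 with hy | hy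
  · have h7 : (I.w i j + I.p i j) * (1 - y) ≤ I.v i * I.sizePr i j (Set.Iic (1 - T)) :=
      mul_le_mul h4 (by linarith) (by linarith) (I.v_nonneg i)
    have h8 := mul_le_mul_of_nonneg_left hp h6
    linarith
  · have h7 := mul_nonneg (I.v_nonneg i) h3
    have h8 := mul_le_mul_of_nonneg_left hy (mul_nonneg (by linarith : 0 ≤ 1 + a) hw)
    linarith

/-- The gain of a choice that is rarely larger than `1 - δ`. -/
theorem gain_ge_of_sizePr_le {δ : ℝ} {i : Fin n} {j : Fin m} {a q : ℝ}
    (ha : 0 ≤ a) (hp : I.p i j ≤ a * I.w i j) (hq0 : 0 ≤ q)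
    (hq : q * (1 + a) ≤ 1) (hpr : I.sizePr i j (Set.Ioi (1 - δ)) ≤ q) {T : ℝ} (hTδ : T ≤ δ) :
    I.w i j * (1 - q * (1 + a)) ≤ I.v i * I.sizePr i j (Set.Iic (1 - T)) - I.p i j := by
  have h1 : I.sizePr i j (Set.Ioi (1 - T)) ≤ q :=
    (I.sizePr_mono i j (Set.Ioi_subset_Ioi (by linarith))).trans hpr
  have h2 := I.sizePr_Iic_add_Ioi i j (1 - T)
  have hq1 : q ≤ 1 := by linarith [mul_nonneg hq0 ha]
  have h7 : (I.w i j + I.p i j) * (1 - q) ≤ I.v i * I.sizePr i j (Set.Iic (1 - T)) :=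
    mul_le_mul (I.w_add_p_le i j) (by linarith) (by linarith) (I.v_nonneg i)
  have h8 := mul_le_mul_of_nonneg_left hp hq0
  linarith

/-! ### The candidate set -/

theorem candW_eq (x : Fin n → Option (Fin m) → ℝ) (i : Fin n) :
    I.candW x i = ∑ j, x i (some j) * I.w i j := by
  simp [candW, Fintype.sum_option, w', mul_comm]

theorem sum_candMu_le {t : ℝ} {x : Fin n → Option (Fin m) → ℝ} (hx : x ∈ I.lpFeasible t) :
    ∑ i, I.candMu t x i ≤ t := hx.1

/-- `∑ j, w i j * μ i j * x i j` for the candidate choice of item `i`. -/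
def candWMu (t : ℝ) (x : Fin n → Option (Fin m) → ℝ) (i : Fin n) : ℝ :=
  ∑ j, x i j * (I.w' i j * I.mu' t i j)

theorem candWMu_eq (t : ℝ) (x : Fin n → Option (Fin m) → ℝ) (i : Fin n) :
    I.candWMu t x i = ∑ j, x i (some j) * (I.w i j * I.mu t i j) := by
  simp [candWMu, Fintype.sum_option, w', mu']

theorem candWMu_eq_mul {t : ℝ} {x : Fin n → Option (Fin m) → ℝ} (hx : x ∈ I.lpFeasible t)
    {i : Fin n} (hi : {j | 0 < x i j}.ncard ≤ 1) :
    I.candWMu t x i = I.candW x i * I.candMu t x i := by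
  obtain ⟨j, hj⟩ := Set.ncard_eq_one.mp (le_antisymm hi (I.one_le_ncard_pos hx i))
  have h0 : ∀ k, k ≠ j → x i k = 0 := fun k hk =>
    le_antisymm (not_lt.mp fun h => hk (by simpa using hj.subset h)) (hx.2.2 i k)
  have hsingle : ∀ f : Option (Fin m) → ℝ, ∑ k, f k * x i k = f j * x i j := fun f =>
    Finset.sum_eq_single j (fun k _ hk => by rw [h0 k hk, mul_zero]) (by simp)
  have h1 : x i j = 1 := by
    have := hsingle fun _ => 1
    simp only [one_mul, hx.2.1 i] at this
    exact this.symm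
  simp only [candWMu, candW, candMu, mul_comm (x i _), hsingle, h1, mul_one]

/-- For the virtual item the mean of `w * μ` need not factor. This bound and `candWMu_le_mul_candW`
replace the product formula there. -/
theorem candWMu_le_Phi_mul {t : ℝ} (ht : 0 ≤ t) {x : Fin n → Option (Fin m) → ℝ}
    (hx : x ∈ I.lpFeasible t) (i : Fin n) :
    I.candWMu t x i ≤ I.Phi t * I.candMu t x i := by
  rw [candWMu, candMu, Finset.mul_sum]
  refine Finset.sum_le_sum fun j _ => ?_
  have := mul_le_mul_of_nonneg_right (I.w'_le_Phi ht i j)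
    (mul_nonneg (I.mu'_nonneg ht i j) (hx.2.2 i j))
  linarith

theorem candWMu_le_mul_candW {t : ℝ} (ht : 0 ≤ t) {x : Fin n → Option (Fin m) → ℝ}
    (hx : I.IsStructuredOptimal t x) (i : Fin n) :
    I.candWMu t x i ≤ t * I.candW x i := by
  rw [candWMu, candW, Finset.mul_sum]
  refine Finset.sum_le_sum fun j _ => ?_
  rcases (hx.feasible.2.2 i j).eq_or_lt with h | h
  · simp [← h]
  · have := mul_le_mul_of_nonneg_left (I.mu'_le ht i j)
      (mul_nonneg h.le (I.w'_nonneg_of_pos ht hx.feasible hx.optimal h))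
    linarith

/-- An item with a single choice contributes `w i * μ i`, where `w i` is at most `Φ / 4`, and there
is at most one other item. -/
theorem sum_candWMu_le {t : ℝ} (ht : 0 ≤ t) {x : Fin n → Option (Fin m) → ℝ}
    (hx : I.IsStructuredOptimal t x) (hsmall : ∀ i, I.candW x i ≤ I.Phi t / 4) :
    ∑ i, I.candWMu t x i - (∑ i, I.candMu t x i * I.candW x i) / 2 ≤
      11 / 32 * (I.Phi t * t) := by
  classical
  have hΦ := I.Phi_nonneg ht
  -- The subtracted half is the diagonal gained in `two_mul_pairSum_le`. For a single choice `w * μ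
  -- / 2 ≤ Φ * μ / 8` remains. For the virtual item, `Φ * μ` and `t * Φ / 4` are mixed with weights
  -- `1/8` and `7/8`.
  have hitem : ∀ i, I.candWMu t x i - I.candMu t x i * I.candW x i / 2 ≤
      I.Phi t / 8 * I.candMu t x i +
        if 1 < {j | 0 < x i j}.ncard then 7 / 32 * (I.Phi t * t) else 0 := by
    intro i
    have hμ := I.candMu_nonneg ht hx.feasible i
    have hw := I.candW_nonneg ht hx i
    split_ifs with h
    · have h1 := I.candWMu_le_Phi_mul ht hx.feasible i
      have h2 := I.candWMu_le_mul_candW ht hx i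
      have h3 := mul_le_mul_of_nonneg_left (hsmall i) ht
      have h4 := mul_nonneg hμ hw
      linarith
    · rw [I.candWMu_eq_mul hx.feasible (not_lt.mp h)]
      have := mul_le_mul_of_nonneg_right (hsmall i) hμ
      linarith
  have hvirt : ∑ i, (if 1 < {j | 0 < x i j}.ncard then 7 / 32 * (I.Phi t * t) else 0) ≤
      7 / 32 * (I.Phi t * t) := by
    have hc : 0 ≤ 7 / 32 * (I.Phi t * t) := by positivity
    by_cases h : ∃ k, 1 < {j | 0 < x k j}.ncard
    · obtain ⟨k, hk⟩ := h
      rw [Finset.sum_eq_single k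
        (fun i _ hik => if_neg fun hi => hik (hx.unique_virtual i k hi hk)) (by simp)]
      rw [if_pos hk]
    · rw [Finset.sum_eq_zero fun i _ => if_neg fun hi => h ⟨i, hi⟩]
      exact hc
  have hsum := Finset.sum_le_sum fun i (_ : i ∈ Finset.univ) => hitem i
  rw [Finset.sum_sub_distrib, Finset.sum_add_distrib, ← Finset.mul_sum, ← Finset.sum_div] at hsum
  have := mul_le_mul_of_nonneg_left (I.sum_candMu_le hx.feasible) hΦ
  linarith

theorem sum_map_of_forall_mem {l : List (Fin n)} (hl : l.Nodup) (hmem : ∀ i, i ∈ l)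
    (f : Fin n → ℝ) : (l.map f).sum = ∑ i, f i := by
  rw [← List.sum_toFinset f hl]
  congr 1
  ext i
  simp [hmem]

theorem pairSum_mul_right (f g : Fin n → ℝ) (c : ℝ) (l : List (Fin n)) :
    pairSum f (fun i => c * g i) l = c * pairSum f g l := by
  induction l with
  | nil => simp [pairSum]
  | cons i l ih =>
    rw [pairSum, pairSum, ih, List.sum_map_mul_left]
    ring

/-! ### The two regimes -/

section regimes

variable {I} {δ : ℝ} (R : I.SKCRun δ)

theorem pairSum_items_le (hmem : ∀ i, i ∈ R.items)
    (hsort : R.items.Pairwise fun i k =>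
      I.candW R.x k * I.candMu δ R.x i ≤ I.candW R.x i * I.candMu δ R.x k) :
    2 * pairSum (I.candMu δ R.x) (I.candW R.x) R.items ≤
      (∑ i, I.candMu δ R.x i) * I.Phi δ - ∑ i, I.candMu δ R.x i * I.candW R.x i := by
  have := two_mul_pairSum_le hsort
  simpa only [sum_map_of_forall_mem R.nodup hmem, R.structured.Phi_eq] using this

/-- All costs are small: Markov's inequality bounds the probability that an item is cut off. -/
theorem SKCRun.boundProfit_ge_of_cost_le (hδ : 0 < δ) (hδ1 : δ ≤ 1)
    (hsmall : ∀ i, I.candW R.x i ≤ I.Phi δ / 4) (hmem : ∀ i, i ∈ R.items)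
    (hsort : R.items.Pairwise fun i k =>
      I.candW R.x k * I.candMu δ R.x i ≤ I.candW R.x i * I.candMu δ R.x k)
    {a : ℝ} (ha : 0 ≤ a) (ha6 : a ≤ 1 / 6)
    (hp : ∀ i j, 0 < R.x i (some j) → I.p i j ≤ a * I.w i j) :
    I.Phi δ / 64 ≤ R.boundProfit := by
  have hx := R.structured
  have hw : ∀ i j, 0 < R.x i (some j) → 0 ≤ I.w i j := fun i j h =>
    I.w'_nonneg_of_pos hδ.le hx.feasible hx.optimal h
  have h1 := I.mixedProfit_ge hδ.le hδ1 hx.feasible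
    (a := fun i j => I.w i j * (1 - (1 + a) * (I.mu δ i j / δ)))
    (b := fun i j => (1 + a) / δ * I.w i j)
    (fun i j h => mul_nonneg (by positivity) (hw i j h))
    (fun i j h => by
      have h2 : 0 ≤ I.w i j * ((1 + a) * (I.mu δ i j / δ)) :=
        mul_nonneg (hw i j h)
          (mul_nonneg (by linarith) (div_nonneg (I.mu_nonneg hδ.le i j) hδ.le))
      have h3 : (1 + a) / δ * I.w i j * δ = (1 + a) * I.w i j := by field_simp
      rw [h3]
      linarith [mul_nonneg ha (hw i j h)])
    (fun i j T h hT hTδ => by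
      refine le_trans (le_of_eq ?_)
        (I.gain_ge_of_cost_le hδ hδ1 ha (hw i j h) (hp i j h) hT)
      ring)
    R.items le_rfl
  have hA : ∀ i, ∑ j, R.x i (some j) * (I.w i j * (1 - (1 + a) * (I.mu δ i j / δ))) =
      I.candW R.x i - (1 + a) / δ * I.candWMu δ R.x i := by
    intro i
    rw [candW_eq, candWMu_eq, Finset.mul_sum, ← Finset.sum_sub_distrib]
    exact Finset.sum_congr rfl fun j _ => by ring
  have hB : ∀ i, ∑ j, R.x i (some j) * ((1 + a) / δ * I.w i j) =
      (1 + a) / δ * I.candW R.x i := by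
    intro i
    rw [candW_eq, Finset.mul_sum]
    exact Finset.sum_congr rfl fun j _ => by ring
  simp only [hA, hB, mul_zero, sub_zero, sum_map_of_forall_mem R.nodup hmem, pairSum_mul_right,
    Finset.sum_sub_distrib, ← Finset.mul_sum, ← hx.Phi_eq, ← R.boundProfit_eq] at h1
  have h2 := pairSum_items_le R hmem hsort
  have h3 := I.sum_candWMu_le hδ.le hx hsmall
  have hΦ := I.Phi_nonneg hδ.le
  have h4 := mul_le_mul_of_nonneg_right (I.sum_candMu_le hx.feasible) hΦ
  -- The diagonal terms cancel, and `27/32 = 11/32 + 1/2`.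
  have h5 : ∑ i, I.candWMu δ R.x i + pairSum (I.candMu δ R.x) (I.candW R.x) R.items ≤
      27 / 32 * (δ * I.Phi δ) := by linarith
  have h6 := mul_le_mul_of_nonneg_left h5 (by positivity : 0 ≤ (1 + a) / δ)
  have h7 : (1 + a) / δ * (27 / 32 * (δ * I.Phi δ)) = (1 + a) * (27 / 32 * I.Phi δ) := by
    field_simp
  -- The threshold `1/6` leaves `1 - (7/6) * (27/32) = 1/64`.
  have h8 := mul_le_mul_of_nonneg_right ha6 (by positivity : 0 ≤ 27 / 32 * I.Phi δ)
  linarith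

/-- All choices are rarely larger than `1 - δ`: no attempted item is expected to lose more than a
constant fraction of its profit. -/
theorem SKCRun.boundProfit_ge_of_sizePr_le (hδ : 0 < δ) (hδ1 : δ ≤ 1) (hmem : ∀ i, i ∈ R.items)
    (hsort : R.items.Pairwise fun i k =>
      I.candW R.x k * I.candMu δ R.x i ≤ I.candW R.x i * I.candMu δ R.x k)
    {a q : ℝ} (ha : 0 ≤ a) (hq0 : 0 ≤ q) (hq : q * (1 + a) ≤ 7 / 8)
    (hp : ∀ i j, 0 < R.x i (some j) → I.p i j ≤ a * I.w i j)
    (hpr : ∀ i j, I.sizePr i j (Set.Ioi (1 - δ)) ≤ q) :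
    I.Phi δ / 16 ≤ R.boundProfit := by
  have hx := R.structured
  have hw : ∀ i j, 0 < R.x i (some j) → 0 ≤ I.w i j := fun i j h =>
    I.w'_nonneg_of_pos hδ.le hx.feasible hx.optimal h
  have h1 := I.mixedProfit_ge hδ.le hδ1 hx.feasible
    -- The gain is at least `w / 8` for every `T ≤ δ`; the slope is added so that the bound vanishes
    -- at `T = δ`, as `mixedProfit_ge` requires.
    (a := fun i j => 1 / 8 * I.w i j) (b := fun i j => 1 / (8 * δ) * I.w i j)
    (fun i j h => mul_nonneg (by positivity) (hw i j h))
    (fun i j h => le_of_eq (by field_simp))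
    (fun i j T h hT hTδ => by
      have h2 := I.gain_ge_of_sizePr_le ha (hp i j h) hq0 (by linarith) (hpr i j) hTδ
      have h3 := mul_le_mul_of_nonneg_left hq (hw i j h)
      have h4 : 0 ≤ 1 / (8 * δ) * I.w i j * T :=
        mul_nonneg (mul_nonneg (by positivity) (hw i j h)) hT
      linarith)
    R.items le_rfl
  have hB : ∀ (c : ℝ) (i : Fin n), ∑ j, R.x i (some j) * (c * I.w i j) = c * I.candW R.x i := by
    intro c i
    rw [candW_eq, Finset.mul_sum]
    exact Finset.sum_congr rfl fun j _ => by ring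
  simp only [hB, mul_zero, sub_zero, sum_map_of_forall_mem R.nodup hmem, pairSum_mul_right,
    ← Finset.mul_sum, ← hx.Phi_eq, ← R.boundProfit_eq] at h1
  have h2 := pairSum_items_le R hmem hsort
  have hΦ := I.Phi_nonneg hδ.le
  have h3 := mul_le_mul_of_nonneg_right (I.sum_candMu_le hx.feasible) hΦ
  have h4 : 0 ≤ ∑ i, I.candMu δ R.x i * I.candW R.x i := Finset.sum_nonneg fun i _ =>
    mul_nonneg (I.candMu_nonneg hδ.le hx.feasible i) (I.candW_nonneg hδ.le hx i)
  have h5 : pairSum (I.candMu δ R.x) (I.candW R.x) R.items ≤ δ * I.Phi δ / 2 := by linarith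
  have h6 := mul_le_mul_of_nonneg_left h5 (by positivity : 0 ≤ 1 / (8 * δ))
  have h7 : 1 / (8 * δ) * (δ * I.Phi δ / 2) = I.Phi δ / 16 := by
    field_simp
    ring
  linarith

end regimes

/-- The definition of the inverse return on investment, for choices of nonnegative net profit. -/
theorem p_le_ior_mul_w {i : Fin n} {j : Fin m} (h0 : I.w i j = 0 → I.p i j = 0)
    (hw : 0 ≤ I.w i j) : I.p i j ≤ I.ior * I.w i j := by
  rcases hw.eq_or_lt with h | h
  · simp [h0 h.symm, ← h]
  · have h1 : (I.roi i j)⁻¹ ≤ I.ior :=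
      le_ciSup (f := fun ij : Fin n × Fin m => (I.roi ij.1 ij.2)⁻¹) (Set.finite_range _).bddAbove
        (i, j)
    rwa [roi, inv_div, div_le_iff₀ h] at h1

theorem SKCRun.Phi_le_boundProfit {I : MSKC n m} {δ : ℝ} (hδ : 0 < δ) (hδ1 : δ ≤ 1)
    (hcost : ∀ i j, I.w i j = 0 → I.p i j = 0)
    (hpr : 0 < I.ior → ∀ i j, I.sizePr i j (Set.Ioi (1 - δ)) ≤ 1 / (2 * n * I.ior))
    (R : I.SKCRun δ) : I.Phi δ / 64 ≤ R.boundProfit := by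
  have hx := R.structured
  have hΦ := I.Phi_nonneg hδ.le
  have hw : ∀ i j, 0 < R.x i (some j) → 0 ≤ I.w i j := fun i j h =>
    I.w'_nonneg_of_pos hδ.le hx.feasible hx.optimal h
  have hp : ∀ i j, 0 < R.x i (some j) → I.p i j ≤ I.ior * I.w i j := fun i j h =>
    I.p_le_ior_mul_w (hcost i j) (hw i j h)
  rcases R.spec with ⟨i, hi, -, hitems⟩ | ⟨hsmall, hmem, hsort⟩
  · rw [R.boundProfit_eq, hitems, mixedProfit_singleton I hδ.le]
    linarith
  rcases hΦ.eq_or_lt with h0 | hpos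
  -- If `Φ = 0`, every used choice has `w = 0`, hence no cost, and `a = 0` serves whatever `α` is.
  · refine R.boundProfit_ge_of_cost_le hδ hδ1 hsmall hmem hsort le_rfl (by norm_num)
      fun i j h => ?_
    have : I.w i j = 0 := le_antisymm (h0 ▸ I.w_le_Phi δ i j) (hw i j h)
    simp [hcost i j this]
  rcases le_total I.ior (1 / 6) with hα | hα
  · refine R.boundProfit_ge_of_cost_le hδ hδ1 hsmall hmem hsort (le_max_right I.ior 0)
      (max_le hα (by norm_num)) fun i j h => (hp i j h).trans ?_
    exact mul_le_mul_of_nonneg_right (le_max_left _ _) (hw i j h)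
  · have hα0 : 0 < I.ior := by linarith
    -- The `n` values `w_i` add up to `Φ > 0`, and each is at most `Φ / 4`.
    have hn : (4 : ℝ) ≤ n := by
      have h1 : I.Phi δ ≤ ∑ _i : Fin n, I.Phi δ / 4 :=
        hx.Phi_eq.trans_le (Finset.sum_le_sum fun i _ => hsmall i)
      rw [Finset.sum_const, Finset.card_univ, Fintype.card_fin, nsmul_eq_mul] at h1
      by_contra h
      have := mul_lt_mul_of_pos_right (not_le.mp h) (by linarith : 0 < I.Phi δ / 4)
      linarith
    have h1 := R.boundProfit_ge_of_sizePr_le hδ hδ1 hmem hsort hα0.le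
      (by positivity : 0 ≤ 1 / (2 * n * I.ior))
      -- With `α ≥ 1/6` and `n ≥ 4`, `(1 + α) / (2nα) = 1/(2nα) + 1/(2n) ≤ 3/4 + 1/8`.
      (by
        rw [div_mul_eq_mul_div, one_mul, div_le_iff₀ (by positivity)]
        have := mul_le_mul_of_nonneg_right hn hα0.le
        linarith) hp (hpr hα0)
    linarith

end MSKC

end

theorem mainTheorem6 :
    ∃ C : ℝ, 0 < C ∧
      ∀ (n m : ℕ) (I : MSKC n m) (δ : ℝ), 0 < δ → δ < 1 →
        (∀ i j, I.w i j = 0 → I.p i j = 0) →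
        (0 < I.ior → ∀ i j, I.sizePr i j (Set.Ioi (1 - δ)) ≤ 1 / (2 * n * I.ior)) →
        Nonempty (I.SKCRun δ) ∧
          ∀ R : I.SKCRun δ, I.ADAPT ≤ C / δ * R.boundProfit := by
  -- The constant is `2 * 64`, from `ADAPT_le_Phi` and `SKCRun.Phi_le_boundProfit`.
  refine ⟨128, by norm_num, fun n m I δ hδ hδ1 hcost hpr =>
    ⟨I.nonempty_SKCRun hδ.le, fun R => (I.ADAPT_le_Phi hδ hδ1.le).trans ?_⟩⟩
  have h := mul_le_mul_of_nonneg_left (R.Phi_le_boundProfit hδ hδ1.le hcost hpr)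
    (by positivity : 0 ≤ 128 / δ)
  refine le_trans (le_of_eq ?_) h
  ring
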